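/- Call a square matrix with entries in $\{0,1\}$ a $0$-$1$ matrix. An $n\times n$ $0$-$1$ matrix $A$ contains a $k\times k$ permutation matrix $P$ ($k\ge 1$) if there are row indices $r_1<\dots<r_k$ and column indices $c_1<\dots<c_k$ such that $A_{r_i,c_j}=1$ whenever $P_{i,j}=1$; otherwise $A$ avoids $P$. Let $S_P(n)$ be the number of $n\times n$ permutation matrices that avoid $P$, and let $\mathrm{ex}(n,P)$ be the maximum number of ones in an $n\times n$ $0$-$1$ matrix that avoids $P$. For real $c>0$ define \[ F(c)=\inf_{t\in\mathbb{N},\,t\ge 1}\frac{(t!)^{1/t}\,15^{c/t}}{c}. \] Then for every permutation matrix $P$ the Stanley–Wilf limit and the Füredi–Hajnal limit \[ s_P=\lim_{n\to\infty}S_P(n)^{1/n},\qquad c_P=\lim_{n\to\infty}\frac{\mathrm{ex}(n,P)}{n} \] exist and are finite, $c_P>0$ unless $P$ is the $1\times 1$ matrix, and \[ s_P\le F(c_P)\,c_P^2 , \] where for the $1\times 1$ matrix $P$, for which $s_P=c_P=0$, the right-hand side is read as $0$. Moreover $F(c)=\log 15+o(1)$ as $c\to\infty$, where $\log$ is the natural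 logarithm. -/

import Mathlib

open Filter Topology

noncomputable section

namespace PermPattern

/-- An `n × n` 0-1 matrix (`true` is a one, `false` is a zero). -/
abbrev ZeroOneMatrix (n : ℕ) : Type := Matrix (Fin n) (Fin n) Bool

/-- `A` is the permutation matrix of some permutation of `Fin n`. -/
def IsPermMatrix {n : ℕ} (A : ZeroOneMatrix n) : Prop :=
  ∃ π : Equiv.Perm (Fin n), ∀ i j, A i j = true ↔ π i = j

/-- `A` contains `P`: some choice of increasing rows and increasing columns
gives a submatrix of `A` that dominates `P` entrywise. -/
def Contains {n k : ℕ} (A : ZeroOneMatrix n) (P : ZeroOneMatrix k) : Prop :=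
  ∃ r c : Fin k → Fin n, StrictMono r ∧ StrictMono c ∧
    ∀ i j, P i j = true → A (r i) (c j) = true

/-- `A` avoids `P`. -/
def Avoids {n k : ℕ} (A : ZeroOneMatrix n) (P : ZeroOneMatrix k) : Prop :=
  ¬ Contains A P

/-- The number of ones of a 0-1 matrix. -/
def ones {n : ℕ} (A : ZeroOneMatrix n) : ℕ :=
  (Finset.univ.filter fun p : Fin n × Fin n => A p.1 p.2 = true).card

open Classical in
/-- `S_P(n)`: the number of `n × n` permutation matrices that avoid `P`. -/
def countAvoiding {k : ℕ} (P : ZeroOneMatrix k) (n : ℕ) : ℕ :=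
  (Finset.univ.filter fun A : ZeroOneMatrix n => IsPermMatrix A ∧ Avoids A P).card

open Classical in
/-- `ex(n, P)`: the maximum number of ones of an `n × n` 0-1 matrix that avoids `P`
(the zero matrix avoids every permutation matrix of positive size). -/
def ex {k : ℕ} (n : ℕ) (P : ZeroOneMatrix k) : ℕ :=
  (Finset.univ.filter fun A : ZeroOneMatrix n => Avoids A P).sup ones

/-- The Stanley–Wilf limit `s_P = lim S_P(n)^{1/n}`. -/
def stanleyWilfLimit {k : ℕ} (P : ZeroOneMatrix k) : ℝ :=
  limUnder atTop fun n : ℕ => (countAvoiding P n : ℝ) ^ (1 / (n : ℝ))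

/-- The Füredi–Hajnal limit `c_P = lim ex(n, P) / n`. -/
def furediHajnalLimit {k : ℕ} (P : ZeroOneMatrix k) : ℝ :=
  limUnder atTop fun n : ℕ => (ex n P : ℝ) / (n : ℝ)

/-- `F(c) = inf_{t ≥ 1} (t!)^{1/t} 15^{c/t} / c`, meant for `c > 0`. -/
def F (c : ℝ) : ℝ :=
  ⨅ t : ℕ+, ((t : ℕ).factorial : ℝ) ^ (1 / ((t : ℕ) : ℝ)) *
    (15 : ℝ) ^ (c / ((t : ℕ) : ℝ)) / c

end PermPattern

end

namespace PermPattern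

/-! Contract the `t × t` blocks of a `P`-avoiding permutation matrix of size `m * t`, with `m = 2 ^
j`. The result `B` avoids `P`, so it has at most `c * m` ones, where `c = c_P`. At most `t! ^ m * c
^ (m * t)` permutations contract to a given `B`: choose a block column for every row (AM-GM on the
row sums of `B`), then the positions inside the blocks (`countAvoiding_mul_le_countMatrices`). There
are at most `15 ^ (c * m)` such `B`, by repeated contraction of `2 × 2` blocks, as a nonzero `2 × 2`
block has 15 possible values (`countMatrices_two_pow_le`). Taking `(m * t)`-th roots and then the
infimum over `t` gives the inequality.

Both limits come from Fekete's lemma: block sums give superadditivity, the Marcus–Tardos recursion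
`ex_mul_le` bounds `ex` linearly, and the count above bounds `countAvoiding` exponentially. For `F`,
Stirling reduces the infimum to minimizing `t / e * 15 ^ (c / t)`, which happens at `t = c * log
15`. -/

/-- The 0-1 matrix of a permutation. -/
def permMatrix {k : ℕ} (π : Equiv.Perm (Fin k)) : ZeroOneMatrix k :=
  fun i j => decide (π i = j)

theorem IsPermMatrix.exists_eq_permMatrix {k : ℕ} {P : ZeroOneMatrix k} (h : IsPermMatrix P) :
    ∃ π : Equiv.Perm (Fin k), P = permMatrix π := by
  obtain ⟨π, hπ⟩ := h
  refine ⟨π, ?_⟩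
  ext i j
  rw [Bool.eq_iff_iff, hπ, permMatrix, decide_eq_true_iff]

theorem isPermMatrix_permMatrix {k : ℕ} (π : Equiv.Perm (Fin k)) :
    IsPermMatrix (permMatrix π) :=
  ⟨π, fun i j => by simp [permMatrix]⟩

theorem permMatrix_injective {k : ℕ} :
    Function.Injective (permMatrix : Equiv.Perm (Fin k) → ZeroOneMatrix k) := by
  intro π σ h
  ext i : 1
  have := congrFun (congrFun h i) (σ i)
  simpa [permMatrix] using this

theorem contains_permMatrix {n k : ℕ} {A : ZeroOneMatrix n} {π : Equiv.Perm (Fin k)} :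
    Contains A (permMatrix π) ↔
      ∃ r c : Fin k → Fin n, StrictMono r ∧ StrictMono c ∧ ∀ i, A (r i) (c (π i)) = true := by
  simp [Contains, permMatrix]

theorem avoids_transpose {n k : ℕ} {A : ZeroOneMatrix n} {π : Equiv.Perm (Fin k)}
    (h : Avoids A (permMatrix π)) : Avoids A.transpose (permMatrix π⁻¹) := by
  rw [Avoids, contains_permMatrix] at h ⊢
  rintro ⟨r, c, hr, hc, H⟩
  exact h ⟨c, r, hc, hr, fun i => by simpa using H (π i)⟩

theorem ones_le_ex {n k : ℕ} {A : ZeroOneMatrix n} {P : ZeroOneMatrix k} (h : Avoids A P) :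
    ones A ≤ ex n P := by
  classical
  unfold ex
  exact Finset.le_sup (f := ones) (by simpa using h)

theorem ex_le {n k N : ℕ} {P : ZeroOneMatrix k}
    (h : ∀ A : ZeroOneMatrix n, Avoids A P → ones A ≤ N) : ex n P ≤ N := by
  unfold ex
  exact Finset.sup_le fun A hA => h A (by simpa using hA)

theorem exists_ones_eq_ex {n k : ℕ} (hk : 1 ≤ k) (π : Equiv.Perm (Fin k)) :
    ∃ A : ZeroOneMatrix n, Avoids A (permMatrix π) ∧ ones A = ex n (permMatrix π) := by
  classical
  have hne : (Finset.univ.filter fun A : ZeroOneMatrix n => Avoids A (permMatrix π)).Nonempty := by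
    refine ⟨fun _ _ => false, Finset.mem_filter.2 ⟨Finset.mem_univ _, ?_⟩⟩
    intro hcon
    obtain ⟨r, c, -, -, H⟩ := contains_permMatrix.1 hcon
    exact absurd (H ⟨0, hk⟩) (by simp)
  obtain ⟨A, hA, h⟩ := Finset.exists_mem_eq_sup _ hne ones
  refine ⟨A, by simpa using hA, ?_⟩
  unfold ex
  rw [← h]

theorem ones_eq_sum {n : ℕ} (A : ZeroOneMatrix n) :
    ones A = ∑ i, (Finset.univ.filter fun j => A i j = true).card := by
  simp only [ones, Finset.card_filter]
  rw [Fintype.sum_prod_type]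

/-! ### Block sums -/

/-- The matrix with diagonal blocks `A` and `B`, where the columns are arranged by `e`. -/
def blockSum {n m : ℕ} (e : Fin n ⊕ Fin m ≃ Fin (n + m)) (A : ZeroOneMatrix n)
    (B : ZeroOneMatrix m) : ZeroOneMatrix (n + m) :=
  fun i j => Sum.elim (fun a => Sum.elim (A a) fun _ => false)
    (fun b => Sum.elim (fun _ => false) (B b)) (finSumFinEquiv.symm i) (e.symm j)

theorem ones_blockSum {n m : ℕ} (e : Fin n ⊕ Fin m ≃ Fin (n + m)) (A : ZeroOneMatrix n)
    (B : ZeroOneMatrix m) : ones (blockSum e A B) = ones A + ones B := by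
  simp only [ones_eq_sum, Finset.card_filter]
  rw [← finSumFinEquiv.sum_comp, Fintype.sum_sum_type]
  congr 1 <;> refine Finset.sum_congr rfl fun i _ => ?_ <;>
    rw [← e.sum_comp, Fintype.sum_sum_type] <;> simp [blockSum]

theorem blockSum_injective {n m : ℕ} (e : Fin n ⊕ Fin m ≃ Fin (n + m)) :
    Function.Injective fun p : ZeroOneMatrix n × ZeroOneMatrix m => blockSum e p.1 p.2 := by
  rintro ⟨A, B⟩ ⟨A', B'⟩ h
  have H : ∀ x y, blockSum e A B (finSumFinEquiv x) (e y) =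
      blockSum e A' B' (finSumFinEquiv x) (e y) := fun x y => congrFun (congrFun h _) _
  refine Prod.ext ?_ ?_
  · ext i j
    simpa [blockSum] using H (.inl i) (.inl j)
  · ext i j
    simpa [blockSum] using H (.inr i) (.inr j)

theorem IsPermMatrix.blockSum {n m : ℕ} (e : Fin n ⊕ Fin m ≃ Fin (n + m)) {A : ZeroOneMatrix n}
    {B : ZeroOneMatrix m} (hA : IsPermMatrix A) (hB : IsPermMatrix B) :
    IsPermMatrix (blockSum e A B) := by
  obtain ⟨σ, hσ⟩ := hA
  obtain ⟨τ, hτ⟩ := hB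
  refine ⟨(finSumFinEquiv.symm.trans (Equiv.sumCongr σ τ)).trans e, fun i j => ?_⟩
  obtain ⟨x, rfl⟩ := finSumFinEquiv.surjective i
  obtain ⟨y, rfl⟩ := e.surjective j
  rcases x with x | x <;> rcases y with y | y <;> simp [PermPattern.blockSum, hσ, hτ]

/-- If the first and last rows of a copy lie in one block, so do all its rows, and hence its
columns, since each column of the pattern has a one. Otherwise the copy starts in `A` and ends in
`B`, and `hsep` orders these blocks against `π 0` and `π (Fin.last k)`. -/
theorem avoids_blockSum {n m k : ℕ} {π : Equiv.Perm (Fin (k + 1))}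
    {e : Fin n ⊕ Fin m ≃ Fin (n + m)}
    (hl : StrictMono fun x => e (.inl x)) (hr : StrictMono fun x => e (.inr x))
    (hsep : ∀ x y, e (.inl x) < e (.inr y) ↔ ¬ π 0 < π (Fin.last k))
    {A : ZeroOneMatrix n} {B : ZeroOneMatrix m}
    (hA : Avoids A (permMatrix π)) (hB : Avoids B (permMatrix π)) :
    Avoids (blockSum e A B) (permMatrix π) := by
  rw [Avoids, contains_permMatrix] at hA hB ⊢
  rintro ⟨r, c, hr', hc, H⟩
  rcases h0 : finSumFinEquiv.symm (r 0) with x | x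
  · rcases h1 : finSumFinEquiv.symm (r (Fin.last k)) with y | y
    · apply hA
      have hrow : ∀ i, ∃ z, r i = finSumFinEquiv (.inl z : Fin n ⊕ Fin m) := by
        intro i
        rw [Equiv.symm_apply_eq] at h1
        have : r i ≤ r (Fin.last k) := hr'.monotone (Fin.le_last i)
        rw [h1, Fin.le_def] at this
        refine ⟨⟨r i, lt_of_le_of_lt this (by simp)⟩, ?_⟩
        ext
        simp
      choose r₁ hr₁ using hrow
      have hcol : ∀ j, ∃ z, c j = e (.inl z) := by
        intro j
        have := H (π⁻¹ j)
        rw [hr₁] at this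
        rcases hz : e.symm (c j) with z | z
        · exact ⟨z, by rwa [Equiv.symm_apply_eq] at hz⟩
        · simp [blockSum, hz] at this
      choose c₁ hc₁ using hcol
      refine ⟨r₁, c₁, fun i j hij => ?_, fun i j hij => ?_, fun i => ?_⟩
      · have := hr' hij
        rw [hr₁, hr₁, Fin.lt_def] at this
        simpa using this
      · have := hc hij
        rw [hc₁, hc₁] at this
        exact hl.lt_iff_lt.1 this
      · have := H i
        rw [hr₁, hc₁] at this
        simpa [blockSum] using this
    · have e0 := H 0
      have e1 := H (Fin.last k)
      rw [blockSum, h0] at e0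
      rw [blockSum, h1] at e1
      rcases hz : e.symm (c (π 0)) with z | z
      · rcases hw : e.symm (c (π (Fin.last k))) with w | w
        · simp [hw] at e1
        · rw [Equiv.symm_apply_eq] at hz hw
          have h2 := hsep z w
          rw [← hz, ← hw, hc.lt_iff_lt] at h2
          tauto
      · simp [hz] at e0
  · apply hB
    have hrow : ∀ i, ∃ z, r i = finSumFinEquiv (.inr z : Fin n ⊕ Fin m) := by
      intro i
      rw [Equiv.symm_apply_eq] at h0
      have : r 0 ≤ r i := hr'.monotone (Fin.zero_le i)
      rw [h0, Fin.le_def] at this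
      have h3 : n ≤ r i := by
        simp at this
        omega
      refine ⟨⟨r i - n, by omega⟩, ?_⟩
      ext
      simp
      omega
    choose r₁ hr₁ using hrow
    have hcol : ∀ j, ∃ z, c j = e (.inr z) := by
      intro j
      have := H (π⁻¹ j)
      rw [hr₁] at this
      rcases hz : e.symm (c j) with z | z
      · simp [blockSum, hz] at this
      · exact ⟨z, by rwa [Equiv.symm_apply_eq] at hz⟩
    choose c₁ hc₁ using hcol
    refine ⟨r₁, c₁, fun i j hij => ?_, fun i j hij => ?_, fun i => ?_⟩
    · have := hr' hij
      rw [hr₁, hr₁, Fin.lt_def] at this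
      simpa using this
    · have := hc hij
      rw [hc₁, hc₁] at this
      exact hr.lt_iff_lt.1 this
    · have := H i
      rw [hr₁, hc₁] at this
      simpa [blockSum] using this

theorem exists_avoids_blockSum {k : ℕ} (π : Equiv.Perm (Fin (k + 1))) (n m : ℕ) :
    ∃ e : Fin n ⊕ Fin m ≃ Fin (n + m), ∀ (A : ZeroOneMatrix n) (B : ZeroOneMatrix m),
      Avoids A (permMatrix π) → Avoids B (permMatrix π) →
      Avoids (blockSum e A B) (permMatrix π) := by
  by_cases h : π 0 < π (Fin.last k)
  -- The columns of `B` precede those of `A`: an antidiagonal sum.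
  · refine ⟨((Equiv.sumComm _ _).trans finSumFinEquiv).trans (finCongr (add_comm m n)),
      fun A B hA hB => avoids_blockSum (fun x y hxy => ?_) (fun x y hxy => ?_)
        (fun x y => ?_) hA hB⟩
    · rw [Fin.lt_def] at *
      simpa using hxy
    · rw [Fin.lt_def] at *
      simpa using hxy
    · simp only [h, not_true, iff_false, not_lt, Fin.le_def]
      simp
      omega
  · refine ⟨finSumFinEquiv,
      fun A B hA hB => avoids_blockSum (fun x y hxy => ?_) (fun x y hxy => ?_)
        (fun x y => ?_) hA hB⟩
    · rw [Fin.lt_def] at *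
      simpa using hxy
    · rw [Fin.lt_def] at *
      simpa using hxy
    · simp only [h, not_false_eq_true, iff_true, Fin.lt_def]
      simp
      omega

theorem ex_add_le {k : ℕ} (hk : 1 ≤ k) (π : Equiv.Perm (Fin k)) (n m : ℕ) :
    ex n (permMatrix π) + ex m (permMatrix π) ≤ ex (n + m) (permMatrix π) := by
  obtain ⟨A, hA, hA'⟩ := exists_ones_eq_ex (n := n) hk π
  obtain ⟨B, hB, hB'⟩ := exists_ones_eq_ex (n := m) hk π
  obtain ⟨k, rfl⟩ := Nat.exists_eq_add_of_le' hk
  obtain ⟨e, he⟩ := exists_avoids_blockSum π n m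
  rw [← hA', ← hB', ← ones_blockSum e]
  exact ones_le_ex (he A B hA hB)

theorem countAvoiding_mul_le {k : ℕ} (hk : 1 ≤ k) (π : Equiv.Perm (Fin k)) (n m : ℕ) :
    countAvoiding (permMatrix π) n * countAvoiding (permMatrix π) m ≤
      countAvoiding (permMatrix π) (n + m) := by
  classical
  obtain ⟨k, rfl⟩ := Nat.exists_eq_add_of_le' hk
  obtain ⟨e, he⟩ := exists_avoids_blockSum π n m
  unfold countAvoiding
  rw [← Finset.card_product]
  refine Finset.card_le_card_of_injOn (fun p => blockSum e p.1 p.2) ?_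
    (blockSum_injective e).injOn
  rintro ⟨A, B⟩ h
  simp only [Finset.coe_product, Set.mem_prod, Finset.mem_coe, Finset.mem_filter,
    Finset.mem_univ, true_and] at h ⊢
  exact ⟨h.1.1.blockSum e h.2.1, he A B h.1.2 h.2.2⟩

/-! ### Contraction of blocks -/

/-- The contraction of the `q × q` blocks of a matrix: a block becomes a one if it
contains a one. -/
def contract {m q : ℕ} (A : ZeroOneMatrix (m * q)) : ZeroOneMatrix m :=
  fun a b => decide (∃ i j, A (finProdFinEquiv (a, i)) (finProdFinEquiv (b, j)) = true)

theorem finProdFinEquiv_lt_of_fst_lt {m q : ℕ} {a b : Fin m} (h : a < b) (i j : Fin q) :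
    finProdFinEquiv (a, i) < finProdFinEquiv (b, j) := by
  rw [Fin.lt_def]
  simp only [finProdFinEquiv_apply_val]
  have h1 : (a : ℕ) + 1 ≤ b := h
  have h2 := Nat.mul_le_mul_left q h1
  have := i.2
  rw [mul_add] at h2
  omega

theorem finProdFinEquiv_lt_of_snd_lt {m q : ℕ} (a : Fin m) {i j : Fin q} (h : i < j) :
    finProdFinEquiv (a, i) < finProdFinEquiv (a, j) := by
  rw [Fin.lt_def] at *
  simpa using h

/-- A copy lifts by picking a one in each block used: distinct ones of a permutation matrix use
distinct block rows and block columns, so the order survives any choice. -/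
theorem avoids_contract {m q k : ℕ} {A : ZeroOneMatrix (m * q)} {π : Equiv.Perm (Fin k)}
    (h : Avoids A (permMatrix π)) : Avoids (contract A) (permMatrix π) := by
  rw [Avoids, contains_permMatrix] at h ⊢
  rintro ⟨r, c, hr, hc, H⟩
  simp only [contract, decide_eq_true_iff] at H
  choose u v H using H
  refine h ⟨fun i => finProdFinEquiv (r i, u i), fun j => finProdFinEquiv (c j, v (π⁻¹ j)),
    fun i j hij => finProdFinEquiv_lt_of_fst_lt (hr hij) _ _,
    fun i j hij => finProdFinEquiv_lt_of_fst_lt (hc hij) _ _, fun i => ?_⟩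
  simpa using H i

/-! ### The Marcus–Tardos recursion -/

/-- The columns of the block `(a, b)` that contain a one. -/
def blockCols {m q : ℕ} (A : ZeroOneMatrix (m * q)) (a b : Fin m) : Finset (Fin q) :=
  Finset.univ.filter fun j => ∃ i, A (finProdFinEquiv (a, i)) (finProdFinEquiv (b, j)) = true

/-- Pigeonhole over the `2 ^ q` column sets: otherwise `k` blocks share a set `W` of at least `k`
columns, and the `i`-th block supplies the `i`-th row of a copy. -/
theorem card_wide_blocks_le {m q k : ℕ} {A : ZeroOneMatrix (m * q)} {π : Equiv.Perm (Fin k)}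
    (h : Avoids A (permMatrix π)) (b : Fin m) :
    (Finset.univ.filter fun a => k ≤ (blockCols A a b).card).card ≤ 2 ^ q * k := by
  by_contra! hlt
  have hcard : (Finset.univ : Finset (Finset (Fin q))).card * k <
      (Finset.univ.filter fun a => k ≤ (blockCols A a b).card).card := by simpa using hlt
  obtain ⟨W, -, hW⟩ := Finset.exists_lt_card_fiber_of_mul_lt_card_of_maps_to
    (f := fun a => blockCols A a b) (fun a _ => Finset.mem_univ _) hcard
  set T := (Finset.univ.filter fun a => k ≤ (blockCols A a b).card).filter
    fun a => blockCols A a b = W with hT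
  have hTW : ∀ a ∈ T, k ≤ (blockCols A a b).card ∧ blockCols A a b = W := by
    intro a ha
    simpa [hT] using ha
  obtain ⟨a₀, ha₀⟩ := Finset.card_pos.1 (lt_of_le_of_lt (Nat.zero_le k) hW)
  have hkW : k ≤ W.card := (hTW a₀ ha₀).2 ▸ (hTW a₀ ha₀).1
  have hex : ∀ i : Fin k, ∃ u, A (finProdFinEquiv (T.orderEmbOfCardLe hW.le i, u))
      (finProdFinEquiv (b, W.orderEmbOfCardLe hkW (π i))) = true := by
    intro i
    have h2 : W.orderEmbOfCardLe hkW (π i) ∈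
        blockCols A (T.orderEmbOfCardLe hW.le i) b :=
      (Finset.ext_iff.1 (hTW _ (T.orderEmbOfCardLe_mem hW.le i)).2 _).2
        (W.orderEmbOfCardLe_mem hkW (π i))
    exact (Finset.mem_filter.1 h2).2
  choose u hu using hex
  exact h (contains_permMatrix.2 ⟨_, fun j => finProdFinEquiv (b, W.orderEmbOfCardLe hkW j),
    fun i j hij => finProdFinEquiv_lt_of_fst_lt
      ((T.orderEmbOfCardLe hW.le).strictMono hij) (u i) (u j),
    fun i j hij => finProdFinEquiv_lt_of_snd_lt b ((W.orderEmbOfCardLe hkW).strictMono hij), hu⟩)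

/-- The ones of the block `(a, b)`. -/
def blockOnes {m q : ℕ} (A : ZeroOneMatrix (m * q)) (a b : Fin m) : Finset (Fin q × Fin q) :=
  Finset.univ.filter fun p => A (finProdFinEquiv (a, p.1)) (finProdFinEquiv (b, p.2)) = true

theorem ones_eq_sum_blockOnes {m q : ℕ} (A : ZeroOneMatrix (m * q)) :
    ones A = ∑ a, ∑ b, (blockOnes A a b).card := by
  simp only [ones_eq_sum, blockOnes, Finset.card_filter]
  rw [← (finProdFinEquiv (m := m) (n := q)).sum_comp, Fintype.sum_prod_type]
  refine Finset.sum_congr rfl fun a _ => ?_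
  simp_rw [Fintype.sum_prod_type]
  conv_rhs => rw [Finset.sum_comm]
  refine Finset.sum_congr rfl fun i _ => ?_
  rw [← (finProdFinEquiv (m := m) (n := q)).sum_comp, Fintype.sum_prod_type]

/-- A block that is neither wide nor tall has its ones in at most `k` rows and `k` columns; the
others are rare and get the trivial bound `q ^ 2`. -/
theorem card_blockOnes_le {m q : ℕ} (A : ZeroOneMatrix (m * q)) (k : ℕ) (a b : Fin m) :
    (blockOnes A a b).card ≤ k ^ 2 * (if contract A a b = true then 1 else 0) +
      q ^ 2 * (if k + 1 ≤ (blockCols A a b).card then 1 else 0) +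
      q ^ 2 * (if k + 1 ≤ (blockCols A.transpose b a).card then 1 else 0) := by
  have hq : (blockOnes A a b).card ≤ q ^ 2 := by
    refine (Finset.card_le_univ _).trans ?_
    simp [sq]
  have hsub : blockOnes A a b ⊆ blockCols A.transpose b a ×ˢ blockCols A a b := by
    rintro ⟨i, j⟩ hij
    simp only [blockOnes, Finset.mem_filter, Finset.mem_univ, true_and] at hij
    simp only [blockCols, Finset.mem_product, Finset.mem_filter, Finset.mem_univ, true_and]
    exact ⟨⟨j, hij⟩, ⟨i, hij⟩⟩
  have hle := Finset.card_le_card hsub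
  rw [Finset.card_product] at hle
  split_ifs with h0 h1 h2 h2 h1 h2 h2 <;> try omega
  · refine (hle.trans (Nat.mul_le_mul (Nat.lt_succ_iff.1 (not_le.1 h2))
      (Nat.lt_succ_iff.1 (not_le.1 h1)))).trans ?_
    rw [sq]
    omega
  · have : blockOnes A a b = ∅ := by
      simp only [contract, decide_eq_true_iff, not_exists] at h0
      ext ⟨i, j⟩
      simpa [blockOnes] using h0 i j
    simp [this]

theorem ex_mul_le {m q k : ℕ} (π : Equiv.Perm (Fin (k + 1))) :
    ex (m * q) (permMatrix π) ≤
      k ^ 2 * ex m (permMatrix π) + 2 * q ^ 2 * (2 ^ q * (k + 1)) * m := by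
  refine ex_le fun A hA => ?_
  rw [ones_eq_sum_blockOnes]
  calc ∑ a, ∑ b, (blockOnes A a b).card
      ≤ ∑ a, ∑ b, (k ^ 2 * (if contract A a b = true then 1 else 0) +
        q ^ 2 * (if k + 1 ≤ (blockCols A a b).card then 1 else 0) +
        q ^ 2 * (if k + 1 ≤ (blockCols A.transpose b a).card then 1 else 0)) :=
        Finset.sum_le_sum fun a _ => Finset.sum_le_sum fun b _ => card_blockOnes_le A k a b
    _ = k ^ 2 * ones (contract A) +
        q ^ 2 * ∑ b, (Finset.univ.filter fun a => k + 1 ≤ (blockCols A a b).card).card +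
        q ^ 2 * ∑ a, (Finset.univ.filter
          fun b => k + 1 ≤ (blockCols A.transpose b a).card).card := by
        simp only [Finset.sum_add_distrib, ← Finset.mul_sum, ones_eq_sum, Finset.card_filter]
        congr 3
        exact Finset.sum_comm
    _ ≤ k ^ 2 * ex m (permMatrix π) + q ^ 2 * ∑ _b : Fin m, 2 ^ q * (k + 1) +
        q ^ 2 * ∑ _a : Fin m, 2 ^ q * (k + 1) := by
        gcongr with b _ a _
        · exact ones_le_ex (avoids_contract hA)
        · exact card_wide_blocks_le hA b
        · exact card_wide_blocks_le (avoids_transpose hA) a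
    _ = _ := by
        simp only [Finset.sum_const, Finset.card_univ, Fintype.card_fin, smul_eq_mul]
        ring

/-! ### Counting matrices with a given contraction -/

open Classical in
/-- The number of `n × n` 0-1 matrices avoiding `P`. -/
noncomputable def countMatrices {k : ℕ} (P : ZeroOneMatrix k) (n : ℕ) : ℕ :=
  (Finset.univ.filter fun A : ZeroOneMatrix n => Avoids A P).card

/-- Blocks over zeros of `B` vanish, and each block over a one is one of the 15 nonzero `2 × 2`
matrices. -/
theorem card_contract_eq_le {m : ℕ} (B : ZeroOneMatrix m) :
    (Finset.univ.filter fun A : ZeroOneMatrix (m * 2) => contract A = B).card ≤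
      15 ^ ones B := by
  classical
  have h15 : Fintype.card {f : Fin 2 → Fin 2 → Bool // ∃ i j, f i j = true} = 15 := by decide
  have hones : Fintype.card {p : Fin m × Fin m // B p.1 p.2 = true} = ones B := by
    rw [Fintype.card_subtype, ones]
  rw [← hones, ← h15, ← Fintype.card_fun, ← Fintype.card_coe]
  refine Fintype.card_le_of_injective (fun A p =>
    ⟨fun i j => A.1 (finProdFinEquiv (p.1.1, i)) (finProdFinEquiv (p.1.2, j)), ?_⟩) ?_
  · have h1 := (Finset.mem_filter.1 A.2).2
    have h2 : contract A.1 p.1.1 p.1.2 = true :=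
      (congrFun (congrFun h1 _) _).trans p.2
    simpa [contract] using h2
  · rintro ⟨A, hA⟩ ⟨A', hA'⟩ h
    replace hA := (Finset.mem_filter.1 hA).2
    replace hA' := (Finset.mem_filter.1 hA').2
    refine Subtype.ext ?_
    ext x y : 2
    obtain ⟨⟨a, i⟩, rfl⟩ := finProdFinEquiv.surjective x
    obtain ⟨⟨b, j⟩, rfl⟩ := finProdFinEquiv.surjective y
    by_cases hB : B a b = true
    · have := congrArg Subtype.val (congrFun h ⟨(a, b), hB⟩)
      exact congrFun (congrFun this i) j
    · have h1 := hB
      have h2 := hB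
      rw [← hA] at h1
      rw [← hA'] at h2
      simp only [contract, decide_eq_true_iff, not_exists, Bool.not_eq_true] at h1 h2
      exact (h1 i j).trans (h2 i j).symm

theorem countMatrices_mul_two_le {m k : ℕ} (π : Equiv.Perm (Fin k)) :
    countMatrices (permMatrix π) (m * 2) ≤
      15 ^ ex m (permMatrix π) * countMatrices (permMatrix π) m := by
  classical
  unfold countMatrices
  refine (Finset.card_le_mul_card_image_of_maps_to (f := contract)
    (t := Finset.univ.filter fun A : ZeroOneMatrix m => Avoids A (permMatrix π)) ?_ _ ?_)
  · intro A hA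
    exact Finset.mem_filter.2
      ⟨Finset.mem_univ _, avoids_contract (Finset.mem_filter.1 hA).2⟩
  · intro B hB
    refine (Finset.card_le_card ?_).trans ((card_contract_eq_le B).trans
      (Nat.pow_le_pow_right (by norm_num) (ones_le_ex (Finset.mem_filter.1 hB).2)))
    intro A hA
    exact Finset.mem_filter.2 ⟨Finset.mem_univ _, (Finset.mem_filter.1 hA).2⟩

/-! ### Counting permutation matrices with a given contraction -/

theorem card_perm_preserving_blocks (m q : ℕ) :
    Fintype.card {σ : Equiv.Perm (Fin (m * q)) //
      ∀ x, (finProdFinEquiv.symm (σ x)).1 = (finProdFinEquiv.symm x).1} = q.factorial ^ m := by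
  classical
  have h := DomMulAct.stabilizer_card (fun x : Fin (m * q) => (finProdFinEquiv.symm x).1)
  have h1 : ∀ a : Fin m,
      Fintype.card {x : Fin (m * q) // (finProdFinEquiv.symm x).1 = a} = q := by
    intro a
    refine (Fintype.card_congr (β := Fin q) ⟨fun x => (finProdFinEquiv.symm x.1).2,
      fun i => ⟨finProdFinEquiv (a, i), by simp⟩, ?_, ?_⟩).trans (Fintype.card_fin q)
    · rintro ⟨x, hx⟩
      subst hx
      exact Subtype.ext (finProdFinEquiv.apply_symm_apply x)
    · intro i
      simp
  simp only [h1, Finset.prod_const, Finset.card_univ, Fintype.card_fin] at h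
  rw [← h]
  exact Fintype.card_congr (Equiv.subtypeEquivRight fun σ => by
    rw [funext_iff]
    rfl)

/-- Map `σ` to the block column of each row. Each block row has `q` rows, hence the power `q`. Two
permutations with the same image differ by one preserving the blocks, which leaves `q.factorial ^ m`
choices. -/
theorem card_perm_contract_eq_le {m q : ℕ} (B : ZeroOneMatrix m) :
    (Finset.univ.filter fun σ : Equiv.Perm (Fin (m * q)) =>
      contract (permMatrix σ) = B).card ≤
      q.factorial ^ m * (∏ a, (Finset.univ.filter fun b => B a b = true).card) ^ q := by
  classical
  have hprod : (∏ a, (Finset.univ.filter fun b => B a b = true).card) ^ q =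
      (Fintype.piFinset fun x : Fin (m * q) =>
        Finset.univ.filter fun b => B (finProdFinEquiv.symm x).1 b = true).card := by
    rw [Fintype.card_piFinset, ← finProdFinEquiv.prod_comp, Fintype.prod_prod_type]
    simp [Finset.prod_pow]
  rw [hprod]
  refine Finset.card_le_mul_card_image_of_maps_to
    (f := fun σ x => (finProdFinEquiv.symm (σ x)).1) ?_ _ ?_
  · intro σ hσ
    replace hσ := (Finset.mem_filter.1 hσ).2
    refine Fintype.mem_piFinset.2 fun x => ?_
    refine Finset.mem_filter.2 ⟨Finset.mem_univ _, ?_⟩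
    rw [← hσ, contract, decide_eq_true_iff]
    exact ⟨(finProdFinEquiv.symm x).2, (finProdFinEquiv.symm (σ x)).2, by
      simp only [permMatrix, Prod.mk.eta, Equiv.apply_symm_apply, decide_true]⟩
  · intro f _
    rcases Finset.eq_empty_or_nonempty ((Finset.univ.filter
      fun σ : Equiv.Perm (Fin (m * q)) => contract (permMatrix σ) = B).filter
        fun σ => (fun x => (finProdFinEquiv.symm (σ x)).1) = f) with h | ⟨σ₀, h⟩
    · rw [h]
      simp
    · rw [← card_perm_preserving_blocks, ← Fintype.card_coe]
      have h0 := congrFun (Finset.mem_filter.1 h).2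
      refine Fintype.card_le_of_injective (fun σ => ⟨σ.1 * σ₀⁻¹, fun x => ?_⟩) ?_
      · have h1 := congrFun (Finset.mem_filter.1 σ.2).2 (σ₀⁻¹ x)
        rw [← h0, ← Equiv.Perm.mul_apply σ₀, mul_inv_cancel] at h1
        exact h1
      · intro σ τ hστ
        exact Subtype.ext (mul_right_cancel (congrArg Subtype.val hστ))

theorem countAvoiding_permMatrix {k n : ℕ} (π : Equiv.Perm (Fin k)) [DecidablePred
    fun σ : Equiv.Perm (Fin n) => Avoids (permMatrix σ) (permMatrix π)] :
    countAvoiding (permMatrix π) n = (Finset.univ.filter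
      fun σ : Equiv.Perm (Fin n) => Avoids (permMatrix σ) (permMatrix π)).card := by
  classical
  unfold countAvoiding
  rw [← Finset.card_image_of_injective _ permMatrix_injective]
  congr 1
  ext A
  simp only [Finset.mem_filter, Finset.mem_univ, true_and, Finset.mem_image]
  constructor
  · rintro ⟨h1, h2⟩
    obtain ⟨σ, rfl⟩ := h1.exists_eq_permMatrix
    exact ⟨σ, h2, rfl⟩
  · rintro ⟨σ, h, rfl⟩
    exact ⟨isPermMatrix_permMatrix σ, h⟩

theorem prod_le_pow_of_sum_le {ι : Type*} [Fintype ι] {d : ι → ℝ} (hd : ∀ i, 0 ≤ d i) {c : ℝ}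
    (h : ∑ i, d i ≤ c * Fintype.card ι) : ∏ i, d i ≤ c ^ Fintype.card ι := by
  rcases isEmpty_or_nonempty ι with hι | hι
  · simp
  have hpos : (0 : ℝ) < Fintype.card ι := by exact_mod_cast Fintype.card_pos
  have hmean := Real.geom_mean_le_arith_mean Finset.univ (fun _ => 1) d (by simp)
    (by simpa using hpos) (fun i _ => hd i)
  simp only [Real.rpow_one, one_mul, Finset.sum_const, Finset.card_univ, nsmul_eq_mul,
    mul_one] at hmean
  have hle := hmean.trans ((div_le_iff₀ hpos).2 h)
  have hprod : 0 ≤ ∏ i, d i := Finset.prod_nonneg fun i _ => hd i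
  calc ∏ i, d i = ((∏ i, d i) ^ ((Fintype.card ι : ℝ)⁻¹)) ^ Fintype.card ι :=
        (Real.rpow_inv_natCast_pow hprod Fintype.card_ne_zero).symm
    _ ≤ c ^ Fintype.card ι := pow_le_pow_left₀ (Real.rpow_nonneg hprod _) hle _

theorem countAvoiding_mul_le_countMatrices {m q k : ℕ} (π : Equiv.Perm (Fin k)) {c : ℝ}
    (hc : (ex m (permMatrix π) : ℝ) ≤ c * m) :
    (countAvoiding (permMatrix π) (m * q) : ℝ) ≤
      (q.factorial : ℝ) ^ m * (c ^ m) ^ q * countMatrices (permMatrix π) m := by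
  classical
  rw [countAvoiding_permMatrix, countMatrices]
  have hmaps : ∀ σ ∈ Finset.univ.filter
      fun σ : Equiv.Perm (Fin (m * q)) => Avoids (permMatrix σ) (permMatrix π),
      contract (permMatrix σ) ∈
        Finset.univ.filter fun A : ZeroOneMatrix m => Avoids A (permMatrix π) := fun σ hσ =>
    Finset.mem_filter.2 ⟨Finset.mem_univ _, avoids_contract (Finset.mem_filter.1 hσ).2⟩
  rw [Finset.card_eq_sum_card_fiberwise hmaps, Nat.cast_sum,
    mul_comm (_ * _ : ℝ), ← nsmul_eq_mul]
  refine Finset.sum_le_card_nsmul _ _ _ fun B hB => ?_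
  have hsum : ∑ a, ((Finset.univ.filter fun b => B a b = true).card : ℝ) ≤
      c * Fintype.card (Fin m) := by
    rw [← Nat.cast_sum, ← ones_eq_sum, Fintype.card_fin]
    exact (Nat.cast_le.2 (ones_le_ex (Finset.mem_filter.1 hB).2)).trans hc
  have hprod := prod_le_pow_of_sum_le (fun a => Nat.cast_nonneg _) hsum
  rw [Fintype.card_fin] at hprod
  calc (_ : ℝ) ≤ ((Finset.univ.filter fun σ : Equiv.Perm (Fin (m * q)) =>
          contract (permMatrix σ) = B).card : ℝ) := by
        refine Nat.cast_le.2 (Finset.card_le_card fun σ hσ => ?_)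
        exact Finset.mem_filter.2 ⟨Finset.mem_univ _, (Finset.mem_filter.1 hσ).2⟩
    _ ≤ (q.factorial : ℝ) ^ m *
        (∏ a, ((Finset.univ.filter fun b => B a b = true).card : ℝ)) ^ q := by
        exact_mod_cast card_perm_contract_eq_le B
    _ ≤ _ := by
        gcongr

/-! ### Asymptotics of `F` -/

theorem div_exp_one_le_factorial_rpow {t : ℕ} (ht : t ≠ 0) :
    t / Real.exp 1 ≤ (t.factorial : ℝ) ^ (1 / (t : ℝ)) := by
  have h := Real.pow_div_factorial_le_exp (x := t) (Nat.cast_nonneg t) t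
  rw [div_le_iff₀ (by positivity)] at h
  have h2 : (t / Real.exp 1 : ℝ) ^ t ≤ t.factorial := by
    rw [div_pow, div_le_iff₀ (by positivity), ← Real.exp_nat_mul, mul_one, mul_comm]
    exact h
  rw [one_div, ← Real.pow_rpow_inv_natCast (x := t / Real.exp 1) (by positivity) ht]
  gcongr

theorem factorial_rpow_le {t : ℕ} (ht : t ≠ 0) :
    (t.factorial : ℝ) ^ (1 / (t : ℝ)) ≤
      t / Real.exp 1 * (Real.exp (1 / t) * (t : ℝ) ^ (1 / (t : ℝ))) := by
  obtain ⟨s, rfl⟩ := Nat.exists_eq_succ_of_ne_zero ht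
  have h := Stirling.stirlingSeq'_antitone (Nat.zero_le s)
  simp only [Function.comp_apply, Nat.succ_eq_add_one, zero_add, Stirling.stirlingSeq_one] at h
  rw [Stirling.stirlingSeq] at h
  set t := s + 1
  have ht1 : (1 : ℝ) ≤ t := by exact_mod_cast Nat.succ_le_succ (Nat.zero_le s)
  rw [div_le_iff₀ (by positivity), Real.sqrt_mul (by norm_num)] at h
  have h2 : (t.factorial : ℝ) ≤ (t / Real.exp 1) ^ t * (Real.exp 1 * t) := by
    calc (t.factorial : ℝ) ≤ Real.exp 1 / √2 * (√2 * √t * (t / Real.exp 1) ^ t) := h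
      _ = (t / Real.exp 1) ^ t * (Real.exp 1 * √t) := by field_simp
      _ ≤ _ := by
        gcongr
        -- Weakening `√t` to `t` is harmless, since `t ^ (1 / t)` still tends to 1.
        exact Real.sqrt_le_iff.2 ⟨by positivity, by nlinarith⟩
  calc (t.factorial : ℝ) ^ (1 / (t : ℝ))
      ≤ ((t / Real.exp 1) ^ t * (Real.exp 1 * t)) ^ (1 / (t : ℝ)) := by gcongr
    _ = _ := by
      rw [Real.mul_rpow (by positivity) (by positivity),
        Real.mul_rpow (by positivity) (by positivity), one_div,
        Real.pow_rpow_inv_natCast (by positivity) (by omega), Real.exp_one_rpow]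

/-- Combines `t! ^ (1 / t) ≥ t / e` with `x ≤ exp (x - 1)` at `x = log 15 * c / t`. -/
theorem log_le_F_term {c : ℝ} (hc : 0 < c) (t : ℕ+) :
    Real.log 15 ≤ ((t : ℕ).factorial : ℝ) ^ (1 / ((t : ℕ) : ℝ)) *
      (15 : ℝ) ^ (c / ((t : ℕ) : ℝ)) / c := by
  have ht : (0 : ℝ) < (t : ℕ) := by exact_mod_cast t.pos
  rw [le_div_iff₀ hc]
  calc Real.log 15 * c = (t : ℕ) * (Real.log 15 * (c / (t : ℕ))) := by field_simp
    _ ≤ (t : ℕ) * Real.exp (Real.log 15 * (c / (t : ℕ)) - 1) := by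
      gcongr
      linarith [Real.add_one_le_exp (Real.log 15 * (c / (t : ℕ)) - 1)]
    _ = (t : ℕ) / Real.exp 1 * (15 : ℝ) ^ (c / (t : ℕ)) := by
      rw [Real.rpow_def_of_pos (by norm_num), Real.exp_sub]
      ring
    _ ≤ _ := by
      gcongr
      exact div_exp_one_le_factorial_rpow t.ne_zero

/-- The upper bound takes `t = ⌈log 15 * c⌉`, where `15 ^ (c / t)` tends to `e` and cancels the `e`
from Stirling. -/
theorem tendsto_F : Tendsto F atTop (𝓝 (Real.log 15)) := by
  have hlog : 0 < Real.log 15 := Real.log_pos (by norm_num)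
  have hτ : Tendsto (fun c : ℝ => (⌈Real.log 15 * c⌉₊ : ℝ)) atTop atTop :=
    tendsto_natCast_atTop_atTop.comp
      (tendsto_nat_ceil_atTop.comp (tendsto_id.const_mul_atTop hlog))
  have hratio : Tendsto (fun c : ℝ => (⌈Real.log 15 * c⌉₊ : ℝ) / c) atTop
      (𝓝 (Real.log 15)) := tendsto_nat_ceil_mul_div_atTop hlog.le
  have hcorr : Tendsto (fun x : ℝ => Real.exp (1 / x) * x ^ (1 / x)) atTop (𝓝 1) := by
    have h1 : Tendsto (fun x : ℝ => 1 / x) atTop (𝓝 0) := by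
      simpa using tendsto_inv_atTop_zero (𝕜 := ℝ)
    simpa using ((Real.continuous_exp.tendsto 0).comp h1).mul tendsto_rpow_div
  have hpow : Tendsto (fun c : ℝ => (15 : ℝ) ^ (c / (⌈Real.log 15 * c⌉₊ : ℝ))) atTop
      (𝓝 (Real.exp 1)) := by
    have h1 : Tendsto (fun c : ℝ => c / (⌈Real.log 15 * c⌉₊ : ℝ)) atTop
        (𝓝 (Real.log 15)⁻¹) := by
      simpa using hratio.inv₀ hlog.ne'
    have h2 := (Real.continuous_const_rpow (a := 15) (by norm_num)).tendsto (Real.log 15)⁻¹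
    have h3 : (15 : ℝ) ^ (Real.log 15)⁻¹ = Real.exp 1 := by
      rw [Real.rpow_def_of_pos (by norm_num), mul_inv_cancel₀ hlog.ne']
    rw [h3] at h2
    exact h2.comp h1
  have hupper : Tendsto (fun c : ℝ => (⌈Real.log 15 * c⌉₊ : ℝ) / c / Real.exp 1 *
      (Real.exp (1 / (⌈Real.log 15 * c⌉₊ : ℝ)) *
        (⌈Real.log 15 * c⌉₊ : ℝ) ^ (1 / (⌈Real.log 15 * c⌉₊ : ℝ))) *
      (15 : ℝ) ^ (c / (⌈Real.log 15 * c⌉₊ : ℝ))) atTop (𝓝 (Real.log 15)) := by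
    have h := ((hratio.div_const (Real.exp 1)).mul (hcorr.comp hτ)).mul hpow
    rw [mul_one, div_mul_cancel₀ _ (Real.exp_pos 1).ne'] at h
    exact h
  refine tendsto_of_tendsto_of_tendsto_of_le_of_le' tendsto_const_nhds hupper ?_ ?_
  · filter_upwards [eventually_gt_atTop 0] with c hc
    exact le_ciInf fun t => log_le_F_term hc t
  · filter_upwards [eventually_gt_atTop 0] with c hc
    have ht : 0 < ⌈Real.log 15 * c⌉₊ := Nat.ceil_pos.2 (by positivity)
    have hbdd : BddBelow (Set.range fun t : ℕ+ => ((t : ℕ).factorial : ℝ) ^ (1 / ((t : ℕ) : ℝ)) *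
        (15 : ℝ) ^ (c / ((t : ℕ) : ℝ)) / c) :=
      ⟨Real.log 15, by
        rintro _ ⟨t, rfl⟩
        exact log_le_F_term hc t⟩
    refine (ciInf_le hbdd ⟨_, ht⟩).trans ?_
    simp only [PNat.mk_coe]
    set t := ⌈Real.log 15 * c⌉₊
    calc (t.factorial : ℝ) ^ (1 / (t : ℝ)) * (15 : ℝ) ^ (c / (t : ℝ)) / c
        ≤ t / Real.exp 1 * (Real.exp (1 / t) * (t : ℝ) ^ (1 / (t : ℝ))) *
          (15 : ℝ) ^ (c / (t : ℝ)) / c := by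
          gcongr
          exact factorial_rpow_le ht.ne'
      _ = _ := by ring

/-! ### Existence of the limits -/

theorem exists_tendsto_div_of_superadditive {u : ℕ → ℝ} {K : ℝ}
    (hu : ∀ n m, u n + u m ≤ u (n + m)) (hK : ∀ n, u n ≤ K * n) :
    ∃ L, Tendsto (fun n : ℕ => u n / n) atTop (𝓝 L) ∧ ∀ n : ℕ, u n ≤ L * n := by
  have hsub : Subadditive fun n => -u n := fun n m => by
    have := hu n m
    linarith
  have hbdd : BddBelow (Set.range fun n : ℕ => -u n / n) := by
    refine ⟨-|K|, ?_⟩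
    rintro _ ⟨n, rfl⟩
    rcases Nat.eq_zero_or_pos n with rfl | hn
    · simp
    have hn' : (0 : ℝ) < n := by exact_mod_cast hn
    simp only
    rw [le_div_iff₀ hn']
    nlinarith [hK n, le_abs_self K]
  refine ⟨-hsub.lim, ?_, fun n => ?_⟩
  · simpa [neg_div] using (hsub.tendsto_lim hbdd).neg
  · rcases Nat.eq_zero_or_pos n with rfl | hn
    · simpa using hK 0
    have hn' : (0 : ℝ) < n := by exact_mod_cast hn
    have h := hsub.lim_le_div hbdd hn.ne'
    rw [le_div_iff₀ hn'] at h
    linarith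

theorem ex_le_linear {k : ℕ} (π : Equiv.Perm (Fin (k + 1))) :
    ∃ K : ℝ, ∀ n : ℕ, (ex n (permMatrix π) : ℝ) ≤ K * n := by
  -- With `k ^ 2 + 1 ≤ q` the recursion reproduces a linear bound at each step.
  obtain ⟨q, hq, hkq⟩ : ∃ q, 2 ≤ q ∧ k ^ 2 + 1 ≤ q := ⟨k ^ 2 + 2, by omega, by omega⟩
  set C := 2 * q ^ 2 * (2 ^ q * (k + 1)) with hC
  have hpow : ∀ j, ex (q ^ j) (permMatrix π) ≤ (C + 1) * q ^ j := by
    intro j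
    induction j with
    | zero =>
      have h1 : ex (q ^ 0) (permMatrix π) ≤ 1 := by
        refine ex_le fun A _ => (Finset.card_le_univ _).trans ?_
        simp
      nlinarith
    | succ j ih =>
      rw [pow_succ]
      refine (ex_mul_le π).trans ?_
      rw [← hC]
      calc k ^ 2 * ex (q ^ j) (permMatrix π) + C * q ^ j
          ≤ k ^ 2 * ((C + 1) * q ^ j) + (C + 1) * q ^ j := by gcongr; omega
        _ = (C + 1) * q ^ j * (k ^ 2 + 1) := by ring
        _ ≤ (C + 1) * q ^ j * q := by gcongr
        _ = _ := by ring
  refine ⟨((C + 1) * q : ℕ), fun n => ?_⟩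
  norm_cast
  rcases Nat.eq_zero_or_pos n with rfl | hn
  · refine ex_le fun A _ => (Finset.card_le_univ _).trans ?_
    simp
  obtain ⟨j, hj, hj'⟩ : ∃ j, n ≤ q ^ j ∧ q ^ j ≤ q * n := by
    -- Rounding `n` up to a power of `q` costs at most a factor `q`.
    refine ⟨Nat.log q n + 1, (Nat.lt_pow_succ_log_self (by omega) n).le, ?_⟩
    rw [pow_succ, mul_comm]
    exact Nat.mul_le_mul_left q (Nat.pow_log_le_self q hn.ne')
  obtain ⟨d, hd⟩ := Nat.exists_eq_add_of_le hj
  calc ex n (permMatrix π) ≤ ex n (permMatrix π) + ex d (permMatrix π) := Nat.le_add_right _ _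
    _ ≤ ex (q ^ j) (permMatrix π) := hd ▸ ex_add_le (Nat.succ_pos k) π n d
    _ ≤ (C + 1) * q ^ j := hpow j
    _ ≤ (C + 1) * (q * n) := by gcongr
    _ = _ := by ring

theorem one_le_ex_one {k : ℕ} (hk : 2 ≤ k) (P : ZeroOneMatrix k) : 1 ≤ ex 1 P := by
  have h : Avoids (fun _ _ => true : ZeroOneMatrix 1) P := by
    rintro ⟨r, -, hr, -⟩
    have := Fintype.card_le_of_injective r hr.injective
    simp at this
    omega
  have h2 := ones_le_ex h
  simpa [ones] using h2

theorem one_le_countAvoiding {k : ℕ} (hk : 2 ≤ k) (π : Equiv.Perm (Fin k)) (n : ℕ) :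
    1 ≤ countAvoiding (permMatrix π) n := by
  classical
  have hsmall : ∀ n ≤ 1, 1 ≤ countAvoiding (permMatrix π) n := by
    intro n hn
    rw [countAvoiding_permMatrix, Nat.one_le_iff_ne_zero, Finset.card_ne_zero]
    refine ⟨1, Finset.mem_filter.2 ⟨Finset.mem_univ _, ?_⟩⟩
    rintro ⟨r, -, hr, -⟩
    have := Fintype.card_le_of_injective r hr.injective
    simp only [Fintype.card_fin] at this
    omega
  induction n with
  | zero => exact hsmall 0 (by omega)
  | succ n ih =>
    exact (Nat.mul_le_mul ih (hsmall 1 le_rfl)).trans (countAvoiding_mul_le (by omega) π n 1)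

/-- Each doubling contributes `15 ^ (c * 2 ^ j)`, exactly squaring the bound. The base case `2 ≤ 15
^ c` is where `1 ≤ c` enters. -/
theorem countMatrices_two_pow_le {k : ℕ} (π : Equiv.Perm (Fin k)) {c : ℝ} (hc1 : 1 ≤ c)
    (hc : ∀ n : ℕ, (ex n (permMatrix π) : ℝ) ≤ c * n) (j : ℕ) :
    (countMatrices (permMatrix π) (2 ^ j) : ℝ) ≤ ((15 : ℝ) ^ c) ^ 2 ^ j := by
  induction j with
  | zero =>
    have h1 : countMatrices (permMatrix π) (2 ^ 0) ≤ 2 := by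
      refine (Finset.card_le_univ _).trans ?_
      change Fintype.card (Fin 1 → Fin 1 → Bool) ≤ 2
      decide
    calc (countMatrices (permMatrix π) (2 ^ 0) : ℝ) ≤ 2 := by exact_mod_cast h1
      _ ≤ (15 : ℝ) ^ (1 : ℝ) := by norm_num
      _ ≤ (15 : ℝ) ^ c := Real.rpow_le_rpow_of_exponent_le (by norm_num) hc1
      _ = _ := by simp
  | succ j ih =>
    rw [pow_succ 2 j]
    have hex : (15 : ℝ) ^ ex (2 ^ j) (permMatrix π) ≤ ((15 : ℝ) ^ c) ^ 2 ^ j := by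
      rw [← Real.rpow_natCast, ← Real.rpow_natCast, ← Real.rpow_mul (by norm_num)]
      exact Real.rpow_le_rpow_of_exponent_le (by norm_num) (hc _)
    calc (countMatrices (permMatrix π) (2 ^ j * 2) : ℝ)
        ≤ (15 : ℝ) ^ ex (2 ^ j) (permMatrix π) * countMatrices (permMatrix π) (2 ^ j) := by
          exact_mod_cast countMatrices_mul_two_le π
      _ ≤ ((15 : ℝ) ^ c) ^ 2 ^ j * ((15 : ℝ) ^ c) ^ 2 ^ j := by gcongr
      _ = _ := by ring

theorem countAvoiding_two_pow_mul_le {k : ℕ} (π : Equiv.Perm (Fin k)) {c : ℝ} (hc1 : 1 ≤ c)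
    (hc : ∀ n : ℕ, (ex n (permMatrix π) : ℝ) ≤ c * n) (j t : ℕ) :
    (countAvoiding (permMatrix π) (2 ^ j * t) : ℝ) ≤
      ((t.factorial : ℝ) * c ^ t * (15 : ℝ) ^ c) ^ 2 ^ j := by
  refine (countAvoiding_mul_le_countMatrices π (by exact_mod_cast hc (2 ^ j))).trans ?_
  calc _ ≤ (t.factorial : ℝ) ^ 2 ^ j * (c ^ 2 ^ j) ^ t * ((15 : ℝ) ^ c) ^ 2 ^ j := by
        gcongr
        exact countMatrices_two_pow_le π hc1 hc j
    _ = _ := by ring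

/-- Fekete's lemma applies to the logarithms. As the full limit exists, it can be bounded along `2 ^
j * t` for each fixed `t`. -/
theorem exists_tendsto_countAvoiding {k : ℕ} (hk : 2 ≤ k) (π : Equiv.Perm (Fin k)) {c : ℝ}
    (hc1 : 1 ≤ c) (hc : ∀ n : ℕ, (ex n (permMatrix π) : ℝ) ≤ c * n) :
    ∃ s : ℝ, Tendsto (fun n : ℕ => (countAvoiding (permMatrix π) n : ℝ) ^ (1 / (n : ℝ))) atTop
      (𝓝 s) ∧ ∀ t : ℕ, t ≠ 0 →
        s ≤ (t.factorial : ℝ) ^ (1 / (t : ℝ)) * (15 : ℝ) ^ (c / (t : ℝ)) * c := by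
  have hpos : ∀ n, (1 : ℝ) ≤ countAvoiding (permMatrix π) n := fun n => by
    exact_mod_cast one_le_countAvoiding hk π n
  have hsup : ∀ n m, Real.log (countAvoiding (permMatrix π) n) +
      Real.log (countAvoiding (permMatrix π) m) ≤
      Real.log (countAvoiding (permMatrix π) (n + m)) := by
    intro n m
    rw [← Real.log_mul (by linarith [hpos n]) (by linarith [hpos m])]
    refine Real.log_le_log (by nlinarith [hpos n, hpos m]) ?_
    exact_mod_cast countAvoiding_mul_le (by omega) π n m
  have hbound : ∀ j t : ℕ, Real.log (countAvoiding (permMatrix π) (2 ^ j * t)) ≤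
      2 ^ j * Real.log ((t.factorial : ℝ) * c ^ t * (15 : ℝ) ^ c) := by
    intro j t
    refine (Real.log_le_log (by linarith [hpos (2 ^ j * t)])
      (countAvoiding_two_pow_mul_le π hc1 hc j t)).trans_eq ?_
    rw [Real.log_pow]
    norm_cast
  have hlin : ∃ K : ℝ, ∀ n : ℕ, Real.log (countAvoiding (permMatrix π) n) ≤ K * n := by
    have hlog : 0 ≤ Real.log (c * (15 : ℝ) ^ c) := Real.log_nonneg
      (by nlinarith [Real.one_le_rpow (by norm_num : (1 : ℝ) ≤ 15) (by linarith : 0 ≤ c)])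
    -- The bound for `t = 1`, doubled because `n` is rounded up to a power of 2.
    refine ⟨2 * Real.log (c * (15 : ℝ) ^ c), fun n => ?_⟩
    rcases Nat.eq_zero_or_pos n with rfl | hn
    · have h1 := hsup 0 0
      simp only [add_zero] at h1
      simp only [Nat.cast_zero, mul_zero]
      linarith
    obtain ⟨j, hj, hj'⟩ : ∃ j, n ≤ 2 ^ j ∧ 2 ^ j ≤ 2 * n := by
      refine ⟨Nat.log 2 n + 1, (Nat.lt_pow_succ_log_self (by omega) n).le, ?_⟩
      rw [pow_succ, mul_comm]
      exact Nat.mul_le_mul_left 2 (Nat.pow_log_le_self 2 hn.ne')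
    obtain ⟨d, hd⟩ := Nat.exists_eq_add_of_le hj
    have h1 := hsup n d
    have h2 := Real.log_nonneg (hpos d)
    have h3 := hbound j 1
    rw [mul_one, hd] at h3
    have h4 : (2 ^ j : ℝ) ≤ 2 * n := by exact_mod_cast hj'
    simp only [Nat.factorial_one, Nat.cast_one, one_mul, pow_one] at h3
    nlinarith
  obtain ⟨K, hK⟩ := hlin
  obtain ⟨L, hL, -⟩ := exists_tendsto_div_of_superadditive hsup hK
  refine ⟨Real.exp L, ?_, fun t ht => ?_⟩
  · refine ((Real.continuous_exp.tendsto L).comp hL).congr fun n => ?_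
    rw [Real.rpow_def_of_pos (by linarith [hpos n]), Function.comp_apply, div_eq_mul_one_div]
  · have ht' : (0 : ℝ) < t := by positivity
    have hsubseq : Tendsto (fun j : ℕ => 2 ^ j * t) atTop atTop :=
      (tendsto_pow_atTop_atTop_of_one_lt (by norm_num)).atTop_mul_const' (by omega)
    have hle : L ≤ Real.log ((t.factorial : ℝ) * c ^ t * (15 : ℝ) ^ c) / t := by
      refine le_of_tendsto (hL.comp hsubseq) (Eventually.of_forall fun j => ?_)
      simp only [Function.comp_apply, Nat.cast_mul, Nat.cast_pow, Nat.cast_ofNat]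
      rw [div_le_div_iff₀ (by positivity) ht']
      nlinarith [hbound j t]
    refine (Real.exp_le_exp.2 hle).trans_eq ?_
    have hc0 : 0 < c := by linarith
    rw [div_eq_mul_one_div, ← Real.rpow_def_of_pos (by positivity),
      Real.mul_rpow (by positivity) (by positivity), Real.mul_rpow (by positivity) (by positivity),
      ← Real.rpow_mul (by norm_num), one_div, Real.pow_rpow_inv_natCast hc0.le ht,
      ← div_eq_mul_inv]
    ring

/-! ### The `1 × 1` pattern -/

theorem contains_of_pos {n : ℕ} (hn : 0 < n) (σ : Equiv.Perm (Fin n))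
    (π : Equiv.Perm (Fin 1)) : Contains (permMatrix σ) (permMatrix π) :=
  contains_permMatrix.2 ⟨fun _ => ⟨0, hn⟩, fun _ => σ ⟨0, hn⟩, Subsingleton.strictMono _,
    Subsingleton.strictMono _, fun _ => by simp [permMatrix]⟩

theorem ex_one_by_one (n : ℕ) (π : Equiv.Perm (Fin 1)) : ex n (permMatrix π) = 0 := by
  refine Nat.le_zero.1 (ex_le fun A hA => ?_)
  rw [Nat.le_zero, ones, Finset.card_eq_zero, Finset.filter_eq_empty_iff]
  rintro ⟨i, j⟩ - h
  exact hA (contains_permMatrix.2 ⟨fun _ => i, fun _ => j, Subsingleton.strictMono _,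
    Subsingleton.strictMono _, fun _ => h⟩)

theorem countAvoiding_one_by_one {n : ℕ} (hn : 0 < n) (π : Equiv.Perm (Fin 1)) :
    countAvoiding (permMatrix π) n = 0 := by
  classical
  rw [countAvoiding_permMatrix, Finset.card_eq_zero, Finset.filter_eq_empty_iff]
  exact fun σ _ h => h (contains_of_pos hn σ π)

end PermPattern

theorem theorem1 :
    (∀ (k : ℕ) (P : PermPattern.ZeroOneMatrix k), 1 ≤ k → PermPattern.IsPermMatrix P →
      Tendsto (fun n : ℕ => (PermPattern.countAvoiding P n : ℝ) ^ (1 / (n : ℝ))) atTop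
        (𝓝 (PermPattern.stanleyWilfLimit P)) ∧
      Tendsto (fun n : ℕ => (PermPattern.ex n P : ℝ) / (n : ℝ)) atTop
        (𝓝 (PermPattern.furediHajnalLimit P)) ∧
      (2 ≤ k → 0 < PermPattern.furediHajnalLimit P) ∧
      PermPattern.stanleyWilfLimit P ≤
        PermPattern.F (PermPattern.furediHajnalLimit P) *
          PermPattern.furediHajnalLimit P ^ 2) ∧
    Tendsto PermPattern.F atTop (𝓝 (Real.log 15)) := by
  refine ⟨fun k P hk hP => ?_, PermPattern.tendsto_F⟩
  obtain ⟨π, rfl⟩ := hP.exists_eq_permMatrix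
  rcases hk.eq_or_lt with rfl | hk2
  · have hs : Tendsto (fun n : ℕ => (PermPattern.countAvoiding (PermPattern.permMatrix π) n : ℝ) ^
        (1 / (n : ℝ))) atTop (𝓝 0) := by
      refine tendsto_const_nhds.congr' ?_
      -- `n = 0` must be excluded: the exponent `1 / 0` is `0`, so that term equals 1.
      filter_upwards [eventually_gt_atTop 0] with n hn
      rw [PermPattern.countAvoiding_one_by_one hn, Nat.cast_zero, Real.zero_rpow (by positivity)]
    have hc : Tendsto (fun n : ℕ => (PermPattern.ex n (PermPattern.permMatrix π) : ℝ) / (n : ℝ))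
        atTop (𝓝 0) := by
      simp [PermPattern.ex_one_by_one]
    rw [PermPattern.stanleyWilfLimit, PermPattern.furediHajnalLimit, hs.limUnder_eq,
      hc.limUnder_eq]
    exact ⟨hs, hc, by omega, by simp⟩
  · obtain ⟨k, rfl⟩ := Nat.exists_eq_add_of_le' hk
    obtain ⟨K, hK⟩ := PermPattern.ex_le_linear π
    obtain ⟨c, hc, hle⟩ := PermPattern.exists_tendsto_div_of_superadditive
      (u := fun n => (PermPattern.ex n (PermPattern.permMatrix π) : ℝ))
      (fun n m => by exact_mod_cast PermPattern.ex_add_le hk π n m) hK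
    -- Fekete's bound `ex n ≤ c * n` holds for every `n`; here it is used at `n = 1`.
    have hc1 : 1 ≤ c := by
      have h1 : (1 : ℝ) ≤ PermPattern.ex 1 (PermPattern.permMatrix π) := by
        exact_mod_cast PermPattern.one_le_ex_one hk2 _
      simpa using h1.trans (hle 1)
    obtain ⟨s, hs, hsle⟩ := PermPattern.exists_tendsto_countAvoiding hk2 π hc1 hle
    rw [PermPattern.stanleyWilfLimit, PermPattern.furediHajnalLimit, hs.limUnder_eq,
      hc.limUnder_eq]
    have hc0 : 0 < c := by linarith
    refine ⟨hs, hc, fun _ => hc0, ?_⟩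
    rw [← div_le_iff₀ (by positivity), PermPattern.F]
    refine le_ciInf fun t => ?_
    rw [div_le_iff₀ (by positivity)]
    refine (hsle t t.ne_zero).trans_eq ?_
    field_simp
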